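/- Let $G$ be a $3$-group that is nilpotent of class at most $5$. Then $\exp(G\wedge G)$ divides $\exp(G)$. Here $\exp$ denotes the exponent of a group (the least positive integer $n$ with $x^n=1$ for all elements $x$, and $0$ if there is none, so that the claim is vacuous when $G$, possibly infinite, has unbounded exponent). With $x^y=y^{-1}xy$, the nonabelian exterior square $G\wedge G$ is the group generated by the symbols $g\wedge h$ $(g,h\in G)$ subject to the relations $$gg'\wedge h=(g^{g'}\wedge h^{g'})(g'\wedge h),\qquad g\wedge hh'=(g\wedge h')(g^{h'}\wedge h^{h'}),\qquad g\wedge g=1$$ for all $g,g',h,h'\in G$. -/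

import Mathlib

/-- Defining relators of the nonabelian exterior square of `G`, on symbols `(g, h)` standing for
`g ∧ h`, for the right action `x ^ y = y⁻¹ * x * y`:
`g * g' ∧ h = (g ^ g' ∧ h ^ g') * (g' ∧ h)`, `g ∧ h * h' = (g ∧ h') * (g ^ h' ∧ h ^ h')`,
`g ∧ g = 1`. -/
inductive ExteriorSquareRel (G : Type*) [Group G] : FreeGroup (G × G) → Prop
  | mul_left (g g' h : G) : ExteriorSquareRel G
      (FreeGroup.of (g * g', h) *
        (FreeGroup.of (g'⁻¹ * g * g', g'⁻¹ * h * g') * FreeGroup.of (g', h))⁻¹)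
  | mul_right (g h h' : G) : ExteriorSquareRel G
      (FreeGroup.of (g, h * h') *
        (FreeGroup.of (g, h') * FreeGroup.of (h'⁻¹ * g * h', h'⁻¹ * h * h'))⁻¹)
  | diag (g : G) : ExteriorSquareRel G (FreeGroup.of (g, g))

/-- The nonabelian exterior square `G ∧ G`. -/
abbrev ExteriorSquare (G : Type*) [Group G] : Type _ :=
  PresentedGroup {r : FreeGroup (G × G) | ExteriorSquareRel G r}

/-! Let N = 3^(e+1) be the exponent of G, and write γ_(n+1) for `lowerCentralSeries n`. In P = (G ∧
G) ⋊ G the identity (y · (y ∧ x))^m = y^m · (y^m ∧ x) (`inr_mul_inl_pow`) shows that y and y · (y ∧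
x) are both killed by N. The Hall–Petrescu formula then expresses (y ∧ x)^N through correction words
raised to the powers C(N, i), 2 ≤ i ≤ 5. All these binomials are divisible by N except C(N, 3),
which is 3^e times a number prime to 3; the cubic word is the difficulty.

G supplies the missing factor 3. Applied inside G, where N-th powers vanish, the same formula shows
that `hallCube` is killed by 3^e. As γ₃ is abelian, its elements killed by 3^e form a normal
subgroup A, and G/A satisfies the law `hallCube` = 1. A nilpotent 3-group with this law is 2-Engel
of class at most three, so A contains γ₄ and all ⁅⁅x, y⁆, y⁆ (`exists_normal_subgroup_pow_eq_one`).

These bounds lift to P because the kernel of P → G centralizes G ∧ G and meets it in the centre: if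
t in G ∧ G has a k-th power that dies in G, that power is central, which bounds the order of ⁅t, u⁆.
This kills the corrections and makes the N-th power map multiplicative on G ∧ G, so generators
suffice (`pow_eq_one_of_central_extension`). -/

open scoped commutatorElement

/-! ### Polynomial sequences in a filtered group and their Taylor expansion. -/

section PolynomialSequences

variable {Q : Type*} [Group Q]

/-- The discrete derivative `m ↦ f(m)⁻¹ f(m+1)` of a sequence in a group. -/
def seqDeriv (f : ℕ → Q) : ℕ → Q := fun m => (f m)⁻¹ * f (m + 1)

/-- `f` is polynomial up to order `s`, with weight shifted by `k`, for the filtration `Γ`: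
for `j ≤ s` its `j`-th discrete derivative takes values in `Γ (k + j)`. -/
def IsPolySeq (Γ : ℕ → Subgroup Q) : ℕ → ℕ → (ℕ → Q) → Prop
  | 0, k, f => ∀ m, f m ∈ Γ k
  | s + 1, k, f => (∀ m, f m ∈ Γ k) ∧ IsPolySeq Γ s (k + 1) (seqDeriv f)

variable {Γ : ℕ → Subgroup Q}

theorem IsPolySeq.mem {s k : ℕ} {f : ℕ → Q} (h : IsPolySeq Γ s k f) (m : ℕ) : f m ∈ Γ k := by
  cases s with
  | zero => exact h m
  | succ s => exact h.1 m

theorem IsPolySeq.of_succ {s k : ℕ} {f : ℕ → Q} (h : IsPolySeq Γ (s + 1) k f) :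
    IsPolySeq Γ s k f := by
  induction s generalizing k f with
  | zero => exact h.1
  | succ s ih => exact ⟨h.1, ih h.2⟩

theorem IsPolySeq.mono (hΓ : Antitone Γ) {s k l : ℕ} {f : ℕ → Q} (h : IsPolySeq Γ s k f)
    (hl : l ≤ k) : IsPolySeq Γ s l f := by
  induction s generalizing k l f with
  | zero => exact fun m => hΓ hl (h m)
  | succ s ih => exact ⟨fun m => hΓ hl (h.1 m), ih h.2 (by omega)⟩

/-- Polynomial sequences are closed under products, inverses and commutators. -/
theorem isPolySeq_closed (hΓ : Antitone Γ) (hc : ∀ i j, ⁅Γ i, Γ j⁆ ≤ Γ (i + j)) (s : ℕ) :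
    (∀ k f g, IsPolySeq Γ s k f → IsPolySeq Γ s k g → IsPolySeq Γ s k (f * g)) ∧
    (∀ k f, IsPolySeq Γ s k f → IsPolySeq Γ s k f⁻¹) ∧
    (∀ k l f g, IsPolySeq Γ s k f → IsPolySeq Γ s l g →
      IsPolySeq Γ s (k + l) (fun m => ⁅f m, g m⁆)) := by
  induction s with
  | zero =>
    exact ⟨fun k f g hf hg m => mul_mem (hf m) (hg m), fun k f hf m => inv_mem (hf m),
      fun k l f g hf hg m => hc k l (Subgroup.commutator_mem_commutator (hf m) (hg m))⟩
  | succ s ih =>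
    obtain ⟨ihm, ihi, ihc⟩ := ih
    -- Conjugates equal a commutator times the original, and derivatives of products and inverses
    -- contain conjugates; hence the joint induction.
    have hconj : ∀ k l f g, IsPolySeq Γ s k f → IsPolySeq Γ s l g →
        IsPolySeq Γ s k (fun m => g m * f m * (g m)⁻¹) := by
      intro k l f g hf hg
      have h := ihm k _ _ ((ihc l k g f hg hf).mono hΓ (Nat.le_add_left k l)) hf
      convert h using 1
      funext m
      simp [commutatorElement_def]
    refine ⟨?_, ?_, ?_⟩
    · intro k f g hf hg
      refine ⟨fun m => mul_mem (hf.1 m) (hg.1 m), ?_⟩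
      have h := ihm _ _ _ (hconj _ _ _ _ hf.2 (ihi _ _ hg.of_succ)) hg.2
      convert h using 1
      funext m
      simp [seqDeriv, mul_assoc]
    · intro k f hf
      refine ⟨fun m => inv_mem (hf.1 m), ?_⟩
      have h := hconj _ _ _ _ (ihi _ _ hf.2) hf.of_succ
      convert h using 1
      funext m
      simp [seqDeriv, mul_assoc]
    · intro k l f g hf hg
      refine ⟨fun m => hc k l (Subgroup.commutator_mem_commutator (hf.1 m) (hg.1 m)), ?_⟩
      have hf0 := hf.of_succ
      have hg0 := hg.of_succ
      have hfg := ihc _ _ _ _ hf0 hg0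
      have hfg' := ihc _ _ _ _ hf0 hg.2
      have hf'g := ihc _ _ _ _ hf.2 hg0
      have hf'g' := ihc _ _ _ _ hf.2 hg.2
      -- With f' and g' the derivatives, ⁅f f', g g'⁆ is the product of conjugates of ⁅f', g⁆ and
      -- ⁅f', g'⁆, then ⁅f, g⁆, then a conjugate of ⁅f, g'⁆.
      have e1 := hconj _ _ _ _ hf'g hf0
      have e2 := (hconj _ _ _ _ (hconj _ _ _ _ hf'g' hg0) hf0).mono hΓ
        (show k + l + 1 ≤ k + 1 + (l + 1) by omega)
      have e3 := hconj _ _ _ _ hfg' hg0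
      have e1' : IsPolySeq Γ s (k + l + 1) _ := e1.mono hΓ (by omega)
      have e3' : IsPolySeq Γ s (k + l + 1) _ := e3.mono hΓ (by omega)
      have e4 := hconj _ _ _ _ e1' (ihi _ _ hfg)
      have e5 := hconj _ _ _ _ e2 (ihi _ _ hfg)
      have h := ihm _ _ _ (ihm _ _ _ e4 e5) e3'
      convert h using 1
      funext m
      simp only [seqDeriv, Pi.mul_apply, Pi.inv_apply, commutatorElement_def]
      group

/-- When the earlier values vanish, the `i`-th derivative at 0 is `f i` itself. -/
theorem IsPolySeq.mem_of_eq_one {s k i : ℕ} {f : ℕ → Q} (h : IsPolySeq Γ s k f)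
    (hf : ∀ j < i, f j = 1) (hi : i ≤ s) : f i ∈ Γ (k + i) := by
  induction i generalizing s k f with
  | zero => exact h.mem 0
  | succ i ih =>
    obtain ⟨s, rfl⟩ : ∃ t, s = t + 1 := ⟨s - 1, by omega⟩
    have h1 := ih h.2 (fun j hj => by simp [seqDeriv, hf j (by omega), hf (j + 1) (by omega)])
      (by omega)
    rw [show k + (i + 1) = k + 1 + i by omega]
    simpa [seqDeriv, hf i (by omega)] using h1

theorem IsPolySeq.eq_one {s k : ℕ} {f : ℕ → Q} (h : IsPolySeq Γ s k f) (hb : Γ (k + s) = ⊥)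
    (hf : ∀ j < s, f j = 1) (m : ℕ) : f m = 1 := by
  induction s generalizing k f m with
  | zero =>
    have h1 := h.mem m
    rw [add_zero] at hb
    rwa [hb, Subgroup.mem_bot] at h1
  | succ s ih =>
    have h1 : ∀ m, seqDeriv f m = 1 :=
      ih h.2 (by rw [← hb]; congr 1; omega)
        (fun j hj => by simp [seqDeriv, hf j (by omega), hf (j + 1) (by omega)])
    induction m with
    | zero => exact hf 0 (by omega)
    | succ m ihm => simpa [seqDeriv, ihm] using h1 m

theorem isPolySeq_one (s k : ℕ) : IsPolySeq Γ s k (fun _ => 1) := by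
  induction s generalizing k with
  | zero => exact fun _ => one_mem _
  | succ s ih =>
    refine ⟨fun _ => one_mem _, ?_⟩
    convert ih (k + 1) using 1
    funext m
    simp [seqDeriv]

/-- By Pascal's rule, differentiation lowers `i` by one. -/
theorem isPolySeq_pow_choose (hΓ : Antitone Γ) {c : Q} (s : ℕ) {k i : ℕ} (hc : c ∈ Γ (k + i)) :
    IsPolySeq Γ s k (fun m => c ^ m.choose i) := by
  induction s generalizing k i with
  | zero => exact fun m => pow_mem (hΓ (Nat.le_add_right k i) hc) _
  | succ s ih =>
    refine ⟨fun m => pow_mem (hΓ (Nat.le_add_right k i) hc) _, ?_⟩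
    cases i with
    | zero =>
      convert isPolySeq_one (Γ := Γ) s (k + 1) using 1
      funext m
      simp [seqDeriv]
    | succ i =>
      have h := ih (k := k + 1) (i := i) (by rwa [show k + 1 + i = k + (i + 1) by omega])
      convert h using 1
      funext m
      simp only [seqDeriv]
      rw [Nat.choose_succ_succ', Nat.add_comm (m.choose i), pow_add, inv_mul_cancel_left]

/-- Taylor expansion of a polynomial sequence. -/
theorem IsPolySeq.exists_taylor (hΓ : Antitone Γ) (hc : ∀ i j, ⁅Γ i, Γ j⁆ ≤ Γ (i + j)) {s : ℕ}
    (hb : Γ s = ⊥) (r i : ℕ) (hri : i + r = s) {f : ℕ → Q} (h : IsPolySeq Γ s 0 f)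
    (hf : ∀ j < i, f j = 1) :
    ∃ c : ℕ → Q, (∀ j, c j ∈ Γ j) ∧
      ∀ m, f m = ((List.range' i r).map fun j => c j ^ m.choose j).prod := by
  induction r generalizing i f with
  | zero =>
    refine ⟨fun _ => 1, fun _ => one_mem _, fun m => ?_⟩
    simpa using h.eq_one (by simpa using hb) (fun j hj => hf j (by omega)) m
  | succ r ih =>
    have hi : f i ∈ Γ i := by simpa using h.mem_of_eq_one hf (by omega)
    obtain ⟨hm, hinv, -⟩ := isPolySeq_closed hΓ hc s
    -- Dividing by the term with coefficient `f i` kills the value at `i` and keeps the earlier ones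
    -- trivial.
    have hg := hm _ _ _ (hinv _ _ (isPolySeq_pow_choose hΓ s (k := 0) (i := i) (c := f i)
      (by simpa using hi))) h
    obtain ⟨c, hcm, hcf⟩ := ih (i + 1) (by omega) hg (fun j hj => by
      rcases Nat.lt_or_ge j i with hj' | hj'
      · simp [hf j hj', Nat.choose_eq_zero_of_lt hj']
      · obtain rfl : j = i := by omega
        simp)
    refine ⟨Function.update c i (f i), fun j => ?_, fun m => ?_⟩
    · by_cases hj : j = i
      · subst hj; simpa using hi
      · simpa [hj] using hcm j
    · have h1 := hcf m
      simp only [Pi.mul_apply, Pi.inv_apply] at h1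
      rw [List.range'_succ, List.map_cons, List.prod_cons, Function.update_self,
        ← inv_mul_eq_iff_eq_mul, h1]
      congr 1
      refine List.map_congr_left fun j hj => ?_
      have : j ≠ i := by
        have := List.mem_range'.1 hj
        omega
      simp [this]

end PolynomialSequences

/-! ### The Hall–Petrescu formula. -/

section HallPetrescu

variable {Q : Type*} [Group Q]

/-- The second Hall–Petrescu word: `(x y)² = x² y² · hallSq x y`. -/
def hallSq (x y : Q) : Q := (x ^ 2 * y ^ 2)⁻¹ * (x * y) ^ 2

/-- The third Hall–Petrescu word: `(x y)³ = x³ y³ · (hallSq x y)³ · hallCube x y`. -/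
def hallCube (x y : Q) : Q := (x ^ 3 * y ^ 3 * hallSq x y ^ 3)⁻¹ * (x * y) ^ 3

/-- The Hall–Petrescu formula for a filtration with trivial sixth term. -/
theorem hall_petrescu {Γ : ℕ → Subgroup Q} (hΓ : Antitone Γ)
    (hc : ∀ i j, ⁅Γ i, Γ j⁆ ≤ Γ (i + j)) (hb : Γ 6 = ⊥) {x y : Q} (hx : x ∈ Γ 1) (hy : y ∈ Γ 1) :
    hallSq x y ∈ Γ 2 ∧ hallCube x y ∈ Γ 3 ∧ ∃ c₄ ∈ Γ 4, ∃ c₅ ∈ Γ 5, ∀ m : ℕ,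
      (x * y) ^ m = x ^ m * y ^ m * (hallSq x y ^ m.choose 2 * hallCube x y ^ m.choose 3 *
        c₄ ^ m.choose 4 * c₅ ^ m.choose 5) := by
  obtain ⟨hm, hinv, -⟩ := isPolySeq_closed hΓ hc 6
  have hpow : ∀ z ∈ Γ 1, IsPolySeq Γ 6 0 (fun m => z ^ m) := fun z hz => by
    simpa using isPolySeq_pow_choose hΓ 6 (k := 0) (i := 1) (c := z) (by simpa using hz)
  have h := hm _ _ _ (hinv _ _ (hm _ _ _ (hpow x hx) (hpow y hy)))
    (hpow (x * y) (mul_mem hx hy))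
  -- The sequence (x^m y^m)⁻¹ (xy)^m is trivial at 0 and 1, so only degrees 2 to 5 occur.
  obtain ⟨c, hcm, hcf⟩ := h.exists_taylor hΓ hc hb 4 2 rfl (fun j hj => by
    interval_cases j <;> simp)
  simp only [Pi.mul_apply, Pi.inv_apply, List.range'_succ, List.range'_zero, List.map_cons,
    List.map_nil, List.prod_cons, List.prod_nil, mul_one] at hcf
  have h2 : hallSq x y = c 2 := by simpa [hallSq, Nat.choose] using hcf 2
  have h3 : hallCube x y = c 3 := by
    have := hcf 3
    simp [Nat.choose] at this
    rw [hallCube, h2, mul_inv_rev, mul_assoc, mul_inv_rev, this]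
    simp
  refine ⟨h2 ▸ hcm 2, h3 ▸ hcm 3, c 4, hcm 4, c 5, hcm 5, fun m => ?_⟩
  rw [h2, h3, ← inv_mul_eq_iff_eq_mul, hcf m]
  simp [mul_assoc]

end HallPetrescu

/-! ### The cubic word in class three, and the Engel condition. -/

section HallCube

variable {K : Type*} [Group K]

/-- Evaluation of `hallCube` on two elements generating a group of class at most three. -/
theorem hallCube_eq_of_relations {x y a b c : K} (hyx : y * x = x * y * a) (hax : a * x = x * a * b)
    (hay : a * y = y * a * c) (hby : b * y = y * b)
    (hcx : c * x = x * c) (hcy : c * y = y * c) (hca : c * a = a * c) (hcb : c * b = b * c) :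
    hallCube x y = b * c ^ 2 := by
  -- Extends each relation to right-associated words, so that `simp` performs the collection
  -- process.
  have lift {u v w : K} (h : u * v = w) (t : K) : u * (v * t) = w * t := by
    rw [← mul_assoc, h]
  have hsq : hallSq x y = a * c := by
    rw [hallSq, inv_mul_eq_iff_eq_mul]
    simp only [pow_succ, pow_zero, one_mul, mul_assoc, lift hyx, hay]
  rw [hallCube, hsq, inv_mul_eq_iff_eq_mul]
  simp only [pow_succ, pow_zero, one_mul, mul_assoc, hay, hcy, lift hyx, lift hax, lift hay,
    lift hby, lift hcx, lift hcy, lift hca, lift hcb]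

theorem mul_eq_of_commutator_mem_center {a g : K} (h : ⁅a, g⁆ ∈ Subgroup.center K) :
    a * g = g * a * ⁅a, g⁆ := by
  rw [← (Subgroup.mem_center_iff.1 h (g * a)).symm, commutatorElement_def]
  group

theorem hallCube_eq_of_commutator_mem_center {x y : K}
    (h : ∀ g, ⁅⁅y⁻¹, x⁻¹⁆, g⁆ ∈ Subgroup.center K) :
    hallCube x y = ⁅⁅y⁻¹, x⁻¹⁆, x⁆ * ⁅⁅y⁻¹, x⁻¹⁆, y⁆ ^ 2 := by
  have hc := fun g u => (Subgroup.mem_center_iff.1 (h g) u).symm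
  exact hallCube_eq_of_relations (by rw [commutatorElement_def]; group)
    (mul_eq_of_commutator_mem_center (h x))
    (mul_eq_of_commutator_mem_center (h y)) (hc _ _) (hc _ _) (hc _ _) (hc _ _) (hc _ _)

theorem IsPGroup.eq_one_of_sq_eq_one (hK : IsPGroup 3 K) {g : K} (hg : g ^ 2 = 1) : g = 1 := by
  obtain ⟨k, hk⟩ := hK g
  have h := Nat.Coprime.pow_left k (show Nat.Coprime 3 2 by norm_num)
  rw [← pow_one g, ← h, pow_gcd_eq_one]
  exact ⟨hk, hg⟩

/-- In a 3-group on which `hallCube` vanishes, pairs of elements generating a subgroup of class at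
most three satisfy the second Engel condition. -/
theorem commute_commutator_of_hallCube_eq_one (hK : IsPGroup 3 K)
    (hlaw : ∀ x y : K, hallCube x y = 1) {v u : K} (h : ∀ g, ⁅⁅v, u⁆, g⁆ ∈ Subgroup.center K) :
    Commute ⁅v, u⁆ u := by
  obtain ⟨y, rfl⟩ : ∃ y, v = y⁻¹ := ⟨v⁻¹, by simp⟩
  obtain ⟨x, rfl⟩ : ∃ x, u = x⁻¹ := ⟨u⁻¹, by simp⟩
  rw [Commute.inv_right_iff]
  have h1 := hallCube_eq_of_commutator_mem_center h
  rw [hlaw] at h1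
  have hx := mul_eq_of_commutator_mem_center (h x)
  have hy := mul_eq_of_commutator_mem_center (h y)
  have hbc := fun u => Subgroup.mem_center_iff.1 (h x) u
  have hcc := fun u => Subgroup.mem_center_iff.1 (h y) u
  have hyx : y * x = x * y * ⁅y⁻¹, x⁻¹⁆ := by rw [commutatorElement_def]; group
  rw [← commutatorElement_eq_one_iff_commute]
  generalize ⁅⁅y⁻¹, x⁻¹⁆, x⁆ = b at *
  generalize ⁅⁅y⁻¹, x⁻¹⁆, y⁆ = c at *
  generalize ⁅y⁻¹, x⁻¹⁆ = a at *
  have hbi : ∀ u, b⁻¹ * u = u * b⁻¹ := fun u => by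
    rw [inv_mul_eq_iff_eq_mul, ← mul_assoc, ← hbc, mul_inv_cancel_right]
  have hya : a⁻¹ * y⁻¹ = y⁻¹ * (a⁻¹ * c) := by
    rw [← mul_assoc, ← mul_inv_rev, ← mul_inv_rev, eq_inv_mul_iff_mul_eq, hy, hcc,
      mul_inv_cancel_right]
  -- Replacing y by y⁻¹ turns (a, b, c) into (a⁻¹c, b⁻¹, c); comparing the two evaluations of the
  -- cubic word gives b = b⁻¹.
  have e1 : y⁻¹ * x = x * y⁻¹ * (a⁻¹ * c) := by
    rw [mul_assoc, ← hya, inv_mul_eq_iff_eq_mul, ← mul_inv_rev, ← mul_assoc, eq_mul_inv_iff_mul_eq,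
      hyx, mul_assoc]
  have e2 : a⁻¹ * c * x = x * (a⁻¹ * c) * b⁻¹ := by
    rw [mul_assoc, ← hcc, ← mul_assoc, ← mul_assoc, mul_assoc _ c, ← hcc, ← mul_assoc, mul_left_inj,
      inv_mul_eq_iff_eq_mul, ← mul_assoc, ← mul_assoc, hx, mul_assoc (x * a), ← hbc]
    group
  have e3 : a⁻¹ * c * y⁻¹ = y⁻¹ * (a⁻¹ * c) * c := by
    rw [← hya, mul_assoc, mul_assoc, hcc]
  have h2 := hallCube_eq_of_relations e1 e2 e3 (hbi _) (hcc _).symm (hcc _).symm (hcc _).symm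
    (hcc _).symm
  rw [hlaw] at h2
  have h3 : b = b⁻¹ := by
    have : b * c ^ 2 = b⁻¹ * c ^ 2 := h1.symm.trans h2
    exact mul_right_cancel this
  exact hK.eq_one_of_sq_eq_one (by rw [sq]; nth_rw 1 [h3]; simp)

end HallCube

/-! ### Lower central series relative to a normal subgroup. -/

section RelativeLowerCentralSeries

variable {P : Type*} [Group P]

/-- The three subgroups lemma modulo a normal subgroup. -/
theorem Subgroup.commutator_commutator_le_of_rotate {A B C N : Subgroup P} [N.Normal]
    (h1 : ⁅⁅B, C⁆, A⁆ ≤ N) (h2 : ⁅⁅C, A⁆, B⁆ ≤ N) : ⁅⁅A, B⁆, C⁆ ≤ N := by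
  have key : ∀ D : Subgroup P, D ≤ N ↔ D.map (QuotientGroup.mk' N) = ⊥ := fun D => by
    rw [Subgroup.map_eq_bot_iff, QuotientGroup.ker_mk']
  rw [key] at h1 h2 ⊢
  simp only [Subgroup.map_commutator] at h1 h2 ⊢
  exact Subgroup.commutator_commutator_eq_bot_of_rotate h1 h2

/-- The descending series `M`, `⁅M, P⁆`, `⁅⁅M, P⁆, P⁆`, … of a subgroup `M` of `P`. -/
def Subgroup.relSeries (M : Subgroup P) : ℕ → Subgroup P
  | 0 => M
  | n + 1 => ⁅M.relSeries n, ⊤⁆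

theorem Subgroup.relSeries_top (n : ℕ) :
    (⊤ : Subgroup P).relSeries n = (⊤ : Subgroup P).lowerCentralSeries n := by
  induction n with
  | zero => rfl
  | succ n ih => rw [Subgroup.relSeries, ih, Subgroup.lowerCentralSeries_succ]

theorem Subgroup.commutator_mem_relSeries (M : Subgroup P) {n : ℕ} {g : P} (hg : g ∈ M.relSeries n)
    (h : P) :
    ⁅g, h⁆ ∈ M.relSeries (n + 1) :=
  Subgroup.commutator_mem_commutator hg (Subgroup.mem_top h)

variable (M : Subgroup P) [M.Normal]

instance Subgroup.relSeries_normal (n : ℕ) : (M.relSeries n).Normal := by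
  induction n with
  | zero => rw [Subgroup.relSeries]; infer_instance
  | succ n ih => rw [Subgroup.relSeries]; infer_instance

theorem Subgroup.relSeries_antitone : Antitone M.relSeries :=
  antitone_nat_of_succ_le fun _ => Subgroup.commutator_le_left _ _

theorem Subgroup.commutator_relSeries_lowerCentralSeries_le (i j : ℕ) :
    ⁅M.relSeries i, (⊤ : Subgroup P).lowerCentralSeries j⁆ ≤ M.relSeries (i + j + 1) := by
  induction j generalizing i with
  | zero => exact le_rfl
  | succ j ih =>
    rw [Subgroup.lowerCentralSeries_succ, Subgroup.commutator_comm]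
    refine Subgroup.commutator_commutator_le_of_rotate ?_ ?_
    · rw [Subgroup.commutator_comm ⊤]
      exact (ih (i + 1)).trans (M.relSeries_antitone (by omega))
    · exact Subgroup.commutator_mono (ih i) le_rfl

theorem Subgroup.commutator_lowerCentralSeries_le (i j : ℕ) :
    ⁅(⊤ : Subgroup P).lowerCentralSeries i, (⊤ : Subgroup P).lowerCentralSeries j⁆ ≤
      (⊤ : Subgroup P).lowerCentralSeries (i + j + 1) := by
  simpa only [Subgroup.relSeries_top] using
    Subgroup.commutator_relSeries_lowerCentralSeries_le (⊤ : Subgroup P) i j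

theorem Subgroup.commutator_mem_lowerCentralSeries {n : ℕ} {g : P}
    (hg : g ∈ (⊤ : Subgroup P).lowerCentralSeries n) (h : P) :
    ⁅g, h⁆ ∈ (⊤ : Subgroup P).lowerCentralSeries (n + 1) :=
  Subgroup.commutator_mem_commutator hg (Subgroup.mem_top h)

theorem Subgroup.lowerCentralSeries_le_center {n : ℕ}
    (h : (⊤ : Subgroup P).lowerCentralSeries (n + 1) = ⊥) :
    (⊤ : Subgroup P).lowerCentralSeries n ≤ Subgroup.center P := by
  rwa [Subgroup.lowerCentralSeries_succ, Subgroup.commutator_top_right_eq_bot_iff_le_center] at h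

theorem Subgroup.map_mk'_lowerCentralSeries (N : Subgroup P) [N.Normal] (n : ℕ) :
    ((⊤ : Subgroup P).lowerCentralSeries n).map (QuotientGroup.mk' N) =
      (⊤ : Subgroup (P ⧸ N)).lowerCentralSeries n := by
  rw [Subgroup.map_lowerCentralSeries,
    Subgroup.map_top_of_surjective _ (QuotientGroup.mk'_surjective N)]

end RelativeLowerCentralSeries

/-! ### Commutator identities modulo central terms. -/

section CommutatorIdentities

variable {K : Type*} [Group K]

theorem commutator_inv_left_of_mem_center {v z : K} (h : ⁅v, z⁆ ∈ Subgroup.center K) :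
    ⁅v⁻¹, z⁆ = ⁅v, z⁆⁻¹ := by
  rw [commutatorElement_inv_left, ← commutatorElement_inv,
    Subgroup.mem_center_iff.1 (inv_mem h) v⁻¹, inv_mul_cancel_right]

theorem commutator_mul_right_of_mem_center {b z w : K} (h : ⁅⁅b, w⁆, z⁆ ∈ Subgroup.center K) :
    ⁅b, z * w⁆ = ⁅b, z⁆ * ⁅b, w⁆ * ⁅⁅b, w⁆, z⁆⁻¹ := by
  rw [commutatorElement_mul_right_eq_mul_conj, mul_assoc, mul_assoc, mul_assoc, mul_right_inj,
    eq_mul_inv_iff_mul_eq, ← mul_assoc, Subgroup.mem_center_iff.1 h, commutatorElement_def _ z]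
  group

theorem commutator_mul_commutator_eq_one_of_mul_mem_center {u v w : K}
    (h : u * v ∈ Subgroup.center K) (hv : ⁅v, w⁆ ∈ Subgroup.center K) : ⁅u, w⁆ * ⁅v, w⁆ = 1 := by
  have h1 : ⁅u * v, w⁆ = 1 := by
    rw [commutatorElement_eq_one_iff_mul_comm, Subgroup.mem_center_iff.1 h]
  rw [commutatorElement_mul_left_eq_conj_mul, Subgroup.mem_center_iff.1 hv,
    mul_inv_cancel_right] at h1
  rwa [← Subgroup.mem_center_iff.1 hv] at h1

/-- Linearization of the second Engel condition. -/
theorem commutator_commutator_mul_swap_eq_one {b : K}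
    (hc : ∀ u v : K, ⁅⁅b, u⁆, v⁆ ∈ Subgroup.center K) (he : ∀ u : K, Commute ⁅b, u⁆ u) (z w : K) :
    ⁅⁅b, z⁆, w⁆ * ⁅⁅b, w⁆, z⁆ = 1 := by
  have h := he (z * w)
  rw [commutator_mul_right_of_mem_center (hc w z)] at h
  have h1 : Commute (⁅b, z⁆ * ⁅b, w⁆) (z * w) := by
    have h2 : Commute ⁅⁅b, w⁆, z⁆ (z * w) :=
      ((Subgroup.mem_center_iff.1 (hc w z)) (z * w)).symm
    have h3 := h.mul_left h2
    rwa [inv_mul_cancel_right] at h3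
  have hz := (he z).eq
  have hw := (he w).eq
  have e1 := mul_eq_of_commutator_mem_center (hc z w)
  have e2 := mul_eq_of_commutator_mem_center (hc w z)
  have c1 := fun u => Subgroup.mem_center_iff.1 (hc z w) u
  have c2 := fun u => Subgroup.mem_center_iff.1 (hc w z) u
  have h2 := h1.eq
  generalize ⁅⁅b, z⁆, w⁆ = k at *
  generalize ⁅⁅b, w⁆, z⁆ = l at *
  generalize ⁅b, z⁆ = p at *
  generalize ⁅b, w⁆ = q at *
  have h3 : p * q * (z * w) = z * w * (p * q) * (k * l) := by
    calc p * q * (z * w) = p * (q * z) * w := by simp only [mul_assoc]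
      _ = p * z * (q * w) * l := by rw [e2]; simp only [mul_assoc, c2 w]
      _ = z * (p * w) * q * l := by rw [hz, hw]; simp only [mul_assoc]
      _ = z * w * (p * q) * (k * l) := by
        rw [e1]
        simp only [mul_assoc]
        rw [← mul_assoc k q, ← c1 q, mul_assoc q]
  rw [h2] at h3
  exact (mul_eq_left.1 h3.symm)

/-- Expand ⁅b, zw⁆ directly and through zw = ⁅z, w⁆wz, then compare. -/
theorem commutator_commutator_right_eq {b z w : K} (h1 : ⁅⁅b, w⁆, z⁆ ∈ Subgroup.center K)
    (h2 : ⁅⁅b, z⁆, w⁆ ∈ Subgroup.center K) (h3 : Commute ⁅b, z⁆ ⁅b, w⁆)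
    (h4 : Commute ⁅z, w⁆ ⁅b, w * z⁆) :
    ⁅b, ⁅z, w⁆⁆ = ⁅⁅b, z⁆, w⁆ * ⁅⁅b, w⁆, z⁆⁻¹ := by
  have e : ⁅b, z * w⁆ = ⁅b, ⁅z, w⁆ * (w * z)⁆ := by
    congr 1
    rw [commutatorElement_def]
    group
  rw [commutatorElement_mul_right_eq_mul_conj b ⁅z, w⁆, mul_assoc ⁅b, ⁅z, w⁆⁆, h4.eq,
    mul_assoc, mul_inv_cancel_right, commutator_mul_right_of_mem_center h1,
    commutator_mul_right_of_mem_center h2, h3.eq] at e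
  have hc := Subgroup.mem_center_iff.1 (mul_mem (inv_mem h1) h2)
  have hc' := Subgroup.mem_center_iff.1 h2 ⁅⁅b, w⁆, z⁆⁻¹
  rw [← mul_inv_eq_iff_eq_mul, mul_inv_rev, inv_inv, ← mul_assoc, mul_assoc _ ⁅⁅b, w⁆, z⁆⁻¹,
    hc, mul_inv_cancel_right, hc'] at e
  exact e.symm

end CommutatorIdentities

/-! ### Nilpotent 3-groups on which the cubic word vanishes. -/

section HallCubeLaw

variable {K : Type*} [Group K]

theorem map_hallCube {L : Type*} [Group L] (f : K →* L) (x y : K) :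
    f (hallCube x y) = hallCube (f x) (f y) := by
  simp [hallCube, hallSq]

theorem hallCube_quotient_eq_one (hlaw : ∀ x y : K, hallCube x y = 1) (N : Subgroup K) [N.Normal]
    (x y : K ⧸ N) : hallCube x y = 1 := by
  obtain ⟨x, rfl⟩ := QuotientGroup.mk'_surjective N x
  obtain ⟨y, rfl⟩ := QuotientGroup.mk'_surjective N y
  rw [← map_hallCube, hlaw, map_one]

theorem commute_commutator_of_lowerCentralSeries_three (hK : IsPGroup 3 K)
    (hlaw : ∀ x y : K, hallCube x y = 1) (h3 : (⊤ : Subgroup K).lowerCentralSeries 3 = ⊥)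
    (v u : K) : Commute ⁅v, u⁆ u :=
  commute_commutator_of_hallCube_eq_one hK hlaw fun g =>
    Subgroup.lowerCentralSeries_le_center h3 (Subgroup.commutator_mem_lowerCentralSeries
      (Subgroup.commutator_mem_lowerCentralSeries (n := 0) (Subgroup.mem_top v) u) g)

/-- A 3-group of class at most four on which `hallCube` vanishes has class at most three. -/
theorem commutator_four_eq_one (hK : IsPGroup 3 K) (hlaw : ∀ x y : K, hallCube x y = 1)
    (h4 : (⊤ : Subgroup K).lowerCentralSeries 4 = ⊥) (x y z w : K) : ⁅⁅⁅x, y⁆, z⁆, w⁆ = 1 := by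
  have m1 : ∀ x y : K, ⁅x, y⁆ ∈ (⊤ : Subgroup K).lowerCentralSeries 1 := fun x y =>
    Subgroup.commutator_mem_lowerCentralSeries (n := 0) (Subgroup.mem_top x) y
  have m2 : ∀ x y z : K, ⁅⁅x, y⁆, z⁆ ∈ (⊤ : Subgroup K).lowerCentralSeries 2 := fun x y z =>
    Subgroup.commutator_mem_lowerCentralSeries (m1 x y) z
  have m3 : ∀ x y z w : K, ⁅⁅⁅x, y⁆, z⁆, w⁆ ∈ Subgroup.center K := fun x y z w =>
    Subgroup.lowerCentralSeries_le_center h4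
      (Subgroup.commutator_mem_lowerCentralSeries (m2 x y z) w)
  have hcomm : ∀ i j, 4 ≤ i + j + 1 → ∀ g ∈ (⊤ : Subgroup K).lowerCentralSeries i,
      ∀ h ∈ (⊤ : Subgroup K).lowerCentralSeries j, Commute g h := by
    intro i j hij g hg h hh
    rw [← commutatorElement_eq_one_iff_commute, ← Subgroup.mem_bot, ← h4]
    exact Subgroup.lowerCentralSeries_antitone _ hij (Subgroup.commutator_lowerCentralSeries_le i j
      (Subgroup.commutator_mem_commutator hg hh))
  let φ := QuotientGroup.mk' (Subgroup.center K)
  have hφ : ∀ g, φ g = 1 ↔ g ∈ Subgroup.center K := fun g => QuotientGroup.eq_one_iff g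
  have hbar : (⊤ : Subgroup (K ⧸ Subgroup.center K)).lowerCentralSeries 3 = ⊥ := by
    rw [← Subgroup.map_mk'_lowerCentralSeries, Subgroup.map_eq_bot_iff, QuotientGroup.ker_mk']
    exact Subgroup.lowerCentralSeries_le_center h4
  have hbarc : ∀ u v t : K ⧸ Subgroup.center K, ⁅⁅u, v⁆, t⁆ ∈ Subgroup.center _ := fun u v t =>
    Subgroup.lowerCentralSeries_le_center hbar (Subgroup.commutator_mem_lowerCentralSeries
      (Subgroup.commutator_mem_lowerCentralSeries (n := 0) (Subgroup.mem_top u) v) t)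
  -- Linearized Engel conditions, here in K and next modulo the centre, make the fourfold commutator
  -- alternating.
  have s34 : ∀ x y z w : K, ⁅⁅⁅x, y⁆, w⁆, z⁆ = ⁅⁅⁅x, y⁆, z⁆, w⁆⁻¹ := fun x y z w => by
    rw [eq_inv_iff_mul_eq_one]
    exact commutator_commutator_mul_swap_eq_one (m3 x y)
      (fun u => commute_commutator_of_hallCube_eq_one hK hlaw (m3 x y u)) w z
  have s23 : ∀ x y z w : K, ⁅⁅⁅x, z⁆, y⁆, w⁆ = ⁅⁅⁅x, y⁆, z⁆, w⁆⁻¹ := fun x y z w => by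
    rw [eq_inv_iff_mul_eq_one]
    refine commutator_mul_commutator_eq_one_of_mul_mem_center ?_ (m3 x y z w)
    rw [← hφ]
    simp only [map_mul, map_commutatorElement]
    exact commutator_commutator_mul_swap_eq_one (hbarc _)
      (fun u => commute_commutator_of_lowerCentralSeries_three (hK.to_quotient _)
        (hallCube_quotient_eq_one hlaw _) hbar _ u) _ _
  have s12 : ∀ x y z w : K, ⁅⁅⁅y, x⁆, z⁆, w⁆ = ⁅⁅⁅x, y⁆, z⁆, w⁆⁻¹ := fun x y z w => by
    rw [eq_inv_iff_mul_eq_one]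
    refine commutator_mul_commutator_eq_one_of_mul_mem_center ?_ (m3 x y z w)
    rw [← hφ, ← commutatorElement_inv x y]
    simp only [map_mul, map_inv, map_commutatorElement]
    rw [commutator_inv_left_of_mem_center (hbarc _ _ _), inv_mul_cancel]
  have hsq : ∀ x y z w : K, ⁅⁅x, y⁆, ⁅z, w⁆⁆ = ⁅⁅⁅x, y⁆, z⁆, w⁆ ^ 2 := fun x y z w => by
    rw [commutator_commutator_right_eq (m3 x y w z) (m3 x y z w)
      (hcomm 2 2 (by norm_num) _ (m2 x y z) _ (m2 x y w))
      (hcomm 1 2 (by norm_num) _ (m1 z w) _ (m2 x y (w * z))), s34 x y z w, inv_inv, sq]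
  -- Exchanging the pairs (x, y) and (z, w) is an even permutation, yet it inverts ⁅⁅x, y⁆, ⁅z, w⁆⁆,
  -- the square of the fourfold commutator; so its fourth power is trivial.
  have e : ⁅⁅⁅z, w⁆, x⁆, y⁆ = ⁅⁅⁅x, y⁆, z⁆, w⁆ := by
    rw [s23 z x w y, s34 z x y w, s12 x z y w, s23 x y z w]
    simp
  have e1 : ⁅⁅⁅x, y⁆, z⁆, w⁆ ^ 2 = (⁅⁅⁅x, y⁆, z⁆, w⁆ ^ 2)⁻¹ := by
    rw [← hsq, commutatorElement_inv, hsq, hsq, e]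
  refine hK.eq_one_of_sq_eq_one (hK.eq_one_of_sq_eq_one ?_)
  nth_rw 1 [sq, e1]
  simp

theorem lowerCentralSeries_three_eq_bot_of_four (hK : IsPGroup 3 K)
    (hlaw : ∀ x y : K, hallCube x y = 1) (h4 : (⊤ : Subgroup K).lowerCentralSeries 4 = ⊥) :
    (⊤ : Subgroup K).lowerCentralSeries 3 = ⊥ := by
  have h2 : ∀ x y z : K, ⁅⁅x, y⁆, z⁆ ∈ Subgroup.center K := fun x y z => by
    rw [Subgroup.mem_center_iff]
    intro w
    exact (commutatorElement_eq_one_iff_mul_comm.1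
      (commutator_four_eq_one hK hlaw h4 x y z w)).symm
  have h1 : (⊤ : Subgroup K).lowerCentralSeries 1 ≤ Subgroup.upperCentralSeries K 2 := by
    rw [Subgroup.lowerCentralSeries_succ, Subgroup.commutator_le]
    intro x _ y _
    rw [Subgroup.mem_upperCentralSeries_succ_iff]
    intro z
    rw [Subgroup.upperCentralSeries_one]
    exact h2 x y z
  rw [Subgroup.lowerCentralSeries_succ, Subgroup.commutator_top_right_eq_bot_iff_le_center,
    Subgroup.lowerCentralSeries_succ, Subgroup.commutator_le, ← Subgroup.upperCentralSeries_one]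
  intro x hx y _
  exact Subgroup.mem_upperCentralSeries_succ_iff.1 (h1 hx) y

/-- A nilpotent 3-group on which `hallCube` vanishes has class at most three. -/
theorem lowerCentralSeries_three_eq_bot (hK : IsPGroup 3 K)
    (hlaw : ∀ x y : K, hallCube x y = 1) {c : ℕ} (hc : (⊤ : Subgroup K).lowerCentralSeries c = ⊥) :
    (⊤ : Subgroup K).lowerCentralSeries 3 = ⊥ := by
  have h := lowerCentralSeries_three_eq_bot_of_four
    (hK.to_quotient ((⊤ : Subgroup K).lowerCentralSeries 4)) (hallCube_quotient_eq_one hlaw _) (by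
      rw [← Subgroup.map_mk'_lowerCentralSeries, Subgroup.map_eq_bot_iff, QuotientGroup.ker_mk'])
  rw [← Subgroup.map_mk'_lowerCentralSeries, Subgroup.map_eq_bot_iff, QuotientGroup.ker_mk'] at h
  -- The quotient by γ₅ gives γ₄ ≤ γ₅, so the series is constant from γ₄ on.
  have hle : ∀ k, (⊤ : Subgroup K).lowerCentralSeries 3 ≤
      (⊤ : Subgroup K).lowerCentralSeries (3 + k) := by
    intro k
    induction k with
    | zero => exact le_rfl
    | succ k ih => exact h.trans (Subgroup.commutator_mono ih le_rfl)
  exact le_bot_iff.1 (((hle c).trans (Subgroup.lowerCentralSeries_antitone _ (by omega))).trans_eq hc)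

end HallCubeLaw

/-! ### Binomial divisibility and multiplicativity of power maps. -/

section PowerMap

theorem three_pow_dvd_choose {k : ℕ} (hk : Nat.Coprime 3 (k + 1)) (e : ℕ) :
    3 ^ e ∣ (3 ^ e).choose (k + 1) := by
  obtain ⟨m, hm⟩ : ∃ m, 3 ^ e = m + 1 := Nat.exists_eq_add_one.2 (by positivity)
  have h : 3 ^ e ∣ (3 ^ e).choose (k + 1) * (k + 1) := by
    rw [hm, ← Nat.add_one_mul_choose_eq]
    exact dvd_mul_right _ _
  exact (Nat.Coprime.pow_left e hk).dvd_of_dvd_mul_right h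

theorem choose_three_pow_succ_three (e : ℕ) :
    (3 ^ (e + 1)).choose 3 = 3 ^ e * (3 ^ (e + 1) - 1).choose 2 := by
  obtain ⟨m, hm⟩ : ∃ m, 3 ^ (e + 1) = m + 1 := Nat.exists_eq_add_one.2 (by positivity)
  have h := Nat.add_one_mul_choose_eq m 2
  rw [← hm, pow_succ] at h
  rw [hm, Nat.add_sub_cancel, ← hm, pow_succ]
  linarith

theorem coprime_three_choose_two (e : ℕ) : Nat.Coprime 3 ((3 ^ (e + 1) - 1).choose 2) := by
  obtain ⟨m, hm⟩ : ∃ m, 3 ^ e = m + 1 := Nat.exists_eq_add_one.2 (by positivity)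
  rw [Nat.Prime.coprime_iff_not_dvd Nat.prime_three, pow_succ', hm]
  intro h
  have h1 := Nat.add_one_mul_choose_eq (3 * m + 1) 1
  rw [Nat.choose_one_right] at h1
  have h2 : 3 ∣ (3 * m + 1 + 1) * (3 * m + 1) := by
    rw [h1]
    exact (show 3 * (m + 1) - 1 = 3 * m + 1 + 1 by omega) ▸ h.mul_right _
  rcases (Nat.Prime.dvd_mul Nat.prime_three).1 h2 with h3 | h3 <;> omega

variable {Q : Type*} [Group Q]

/-- If the Hall–Petrescu words have sufficiently small order, then taking `3 ^ (e + 1)`-th powers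
is multiplicative. -/
theorem mul_pow_three_pow {Γ : ℕ → Subgroup Q} (hΓ : Antitone Γ)
    (hc : ∀ i j, ⁅Γ i, Γ j⁆ ≤ Γ (i + j)) (hb : Γ 6 = ⊥) {x y : Q} (hx : x ∈ Γ 1) (hy : y ∈ Γ 1)
    {e : ℕ} (h2 : hallSq x y ^ 3 ^ (e + 1) = 1) (h3 : hallCube x y ^ 3 ^ e = 1)
    (h4 : ∀ c ∈ Γ 4, c ^ 3 ^ (e + 1) = 1) :
    (x * y) ^ 3 ^ (e + 1) = x ^ 3 ^ (e + 1) * y ^ 3 ^ (e + 1) := by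
  obtain ⟨-, -, c₄, hc₄, c₅, hc₅, h⟩ := hall_petrescu hΓ hc hb hx hy
  have key {g : Q} {a b : ℕ} (hg : g ^ a = 1) (hab : a ∣ b) : g ^ b = 1 := by
    obtain ⟨k, rfl⟩ := hab
    rw [pow_mul, hg, one_pow]
  rw [h, key h2 (three_pow_dvd_choose (k := 1) (by norm_num) _),
    key h3 (Dvd.intro _ (choose_three_pow_succ_three e).symm),
    key (h4 c₄ hc₄) (three_pow_dvd_choose (k := 3) (by norm_num) _),
    key (h4 c₅ (hΓ (by norm_num) hc₅)) (three_pow_dvd_choose (k := 4) (by norm_num) _)]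
  simp

/-- Reindexing of a central series by weight. -/
theorem commutator_le_of_series {F : ℕ → Subgroup Q} [∀ i, (F i).Normal] (w : ℕ)
    (hF : ∀ i j, ⁅F i, F j⁆ ≤ F (i + j + w)) (i j : ℕ) :
    ⁅F (w * (i - 1)), F (w * (j - 1))⁆ ≤ F (w * (i + j - 1)) := by
  rcases i with _ | i
  · simpa using Subgroup.commutator_le_right (F 0) (F (w * (j - 1)))
  rcases j with _ | j
  · simpa using Subgroup.commutator_le_left (F (w * i)) (F 0)
  · refine (hF _ _).trans (le_of_eq ?_)
    congr 1
    simp only [Nat.add_sub_cancel]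
    rw [show i + 1 + (j + 1) - 1 = i + j + 1 by omega]
    ring

/-- Conjugation by u fixes t^k, while u t u⁻¹ = ⁅t, u⁆⁻¹ t has k-th power ⁅t, u⁆^(-k) t^k. -/
theorem commutator_pow_eq_one {t u : Q} {k : ℕ} (h1 : Commute ⁅t, u⁆ t) (h2 : Commute (t ^ k) u) :
    ⁅t, u⁆ ^ k = 1 := by
  have h3 : u * t * u⁻¹ = ⁅t, u⁆⁻¹ * t := by
    rw [commutatorElement_def]
    group
  have h4 : (u * t * u⁻¹) ^ k = t ^ k := by
    rw [conj_pow, ← h2.eq, mul_inv_cancel_right]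
  rw [h3, (h1.inv_left).mul_pow, mul_eq_right, inv_pow, inv_eq_one] at h4
  exact h4

theorem pow_eq_one_of_mem_closure {S : Set Q} {k : ℕ} (hS : ∀ s ∈ S, s ^ k = 1)
    (hmul : ∀ a ∈ Subgroup.closure S, ∀ b ∈ Subgroup.closure S, (a * b) ^ k = a ^ k * b ^ k)
    {g : Q} (hg : g ∈ Subgroup.closure S) : g ^ k = 1 := by
  induction hg using Subgroup.closure_induction with
  | mem x hx => exact hS x hx
  | one => simp
  | mul x y hx hy ihx ihy => rw [hmul x hx y hy, ihx, ihy, one_mul]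
  | inv x hx ih => rw [inv_pow, ih, inv_one]

theorem pow_eq_one_of_mem_commutator_top {B : Subgroup Q} {k : ℕ}
    (h : ∀ t ∈ B, ∀ u : Q, ⁅t, u⁆ ^ k = 1)
    (hmul : ∀ a ∈ ⁅B, (⊤ : Subgroup Q)⁆, ∀ b ∈ ⁅B, (⊤ : Subgroup Q)⁆, (a * b) ^ k = a ^ k * b ^ k)
    {g : Q} (hg : g ∈ ⁅B, (⊤ : Subgroup Q)⁆) : g ^ k = 1 := by
  rw [Subgroup.commutator_def] at hg hmul
  refine pow_eq_one_of_mem_closure ?_ hmul hg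
  rintro _ ⟨t, ht, u, -, rfl⟩
  exact h t ht u

end PowerMap

/-! ### Elements killed by 3^e in class five. -/

section ClassFive

variable {G : Type*} [Group G]

/-- In a group of exponent dividing `3 ^ (e + 1)` and class at most five, the fourth term of the
lower central series and all `⁅⁅x, y⁆, y⁆` are killed by `3 ^ e`. -/
theorem exists_normal_subgroup_pow_eq_one {e : ℕ} (hG : ∀ g : G, g ^ 3 ^ (e + 1) = 1)
    (h5 : (⊤ : Subgroup G).lowerCentralSeries 5 = ⊥) :
    ∃ A : Subgroup G, A.Normal ∧ (∀ a ∈ A, a ^ 3 ^ e = 1) ∧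
      (⊤ : Subgroup G).lowerCentralSeries 3 ≤ A ∧ ∀ x y : G, ⁅⁅x, y⁆, y⁆ ∈ A := by
  have hcomm : ∀ a ∈ (⊤ : Subgroup G).lowerCentralSeries 2,
      ∀ b ∈ (⊤ : Subgroup G).lowerCentralSeries 2, Commute a b := by
    intro a ha b hb
    rw [← commutatorElement_eq_one_iff_commute, ← Subgroup.mem_bot, ← h5]
    exact Subgroup.commutator_lowerCentralSeries_le 2 2 (Subgroup.commutator_mem_commutator ha hb)
  let A : Subgroup G :=
    { carrier := {g | g ∈ (⊤ : Subgroup G).lowerCentralSeries 2 ∧ g ^ 3 ^ e = 1}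
      mul_mem' := fun {a b} ha hb => ⟨mul_mem ha.1 hb.1, by
        rw [(hcomm a ha.1 b hb.1).mul_pow, ha.2, hb.2, one_mul]⟩
      one_mem' := ⟨one_mem _, one_pow _⟩
      inv_mem' := fun {a} ha => ⟨inv_mem ha.1, by rw [inv_pow, ha.2, inv_one]⟩ }
  have hA : A.Normal := ⟨fun a ha g => ⟨Subgroup.Normal.conj_mem inferInstance a ha.1 g, by
    rw [conj_pow, ha.2, mul_one, mul_inv_cancel]⟩⟩
  have hcube : ∀ x y : G, hallCube x y ∈ A := by
    intro x y
    obtain ⟨-, h3, c₄, -, c₅, -, h⟩ := hall_petrescu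
      (Γ := fun i => (⊤ : Subgroup G).lowerCentralSeries (1 * (i - 1)))
      (fun i j hij => Subgroup.lowerCentralSeries_antitone _ (by omega))
      (commutator_le_of_series 1 Subgroup.commutator_lowerCentralSeries_le)
      h5 (x := x) (y := y) (Subgroup.mem_top x) (Subgroup.mem_top y)
    refine ⟨h3, ?_⟩
    have key (g : G) {b : ℕ} (hab : 3 ^ (e + 1) ∣ b) : g ^ b = 1 := by
      obtain ⟨k, rfl⟩ := hab
      rw [pow_mul, hG, one_pow]
    have h' := h (3 ^ (e + 1))
    rw [hG, hG, hG, key _ (three_pow_dvd_choose (k := 1) (by norm_num) _),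
      key _ (three_pow_dvd_choose (k := 3) (by norm_num) _),
      key _ (three_pow_dvd_choose (k := 4) (by norm_num) _), choose_three_pow_succ_three] at h'
    simp only [one_mul, mul_one] at h'
    have h1 := hG (hallCube x y)
    rw [pow_succ, pow_mul] at h1
    rw [pow_mul] at h'
    -- This power is killed both by 3 and by a number prime to 3.
    rw [← pow_one (hallCube x y ^ 3 ^ e), ← (coprime_three_choose_two e), pow_gcd_eq_one]
    exact ⟨h1, h'.symm⟩
  have hlaw : ∀ x y : G ⧸ A, hallCube x y = 1 := by
    intro x y
    obtain ⟨x, rfl⟩ := QuotientGroup.mk'_surjective A x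
    obtain ⟨y, rfl⟩ := QuotientGroup.mk'_surjective A y
    rw [← map_hallCube]
    exact (QuotientGroup.eq_one_iff _).2 (hcube x y)
  have hP : IsPGroup 3 (G ⧸ A) := IsPGroup.to_quotient (fun g => ⟨e + 1, hG g⟩) A
  have h3 := lowerCentralSeries_three_eq_bot hP hlaw (c := 5) (by
    rw [← Subgroup.map_mk'_lowerCentralSeries, h5, Subgroup.map_bot])
  refine ⟨A, hA, fun a ha => ha.2, ?_, fun x y => ?_⟩
  · rwa [← Subgroup.map_mk'_lowerCentralSeries, Subgroup.map_eq_bot_iff,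
      QuotientGroup.ker_mk'] at h3
  · rw [← QuotientGroup.eq_one_iff]
    exact commutatorElement_eq_one_iff_commute.2
      (commute_commutator_of_lowerCentralSeries_three hP hlaw h3 (x : G ⧸ A) (y : G ⧸ A))

end ClassFive

/-! ### Lifting the exponent bound to the extension. -/

section CentralExtension

variable {P G : Type*} [Group P] [Group G] (M : Subgroup P) (π : P →* G)

theorem map_relSeries_le (hM : M.map π ≤ (⊤ : Subgroup G).lowerCentralSeries 1) (k : ℕ) :
    (M.relSeries k).map π ≤ (⊤ : Subgroup G).lowerCentralSeries (k + 1) := by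
  induction k with
  | zero => exact hM
  | succ k ih =>
    rw [Subgroup.relSeries, Subgroup.map_commutator]
    exact Subgroup.commutator_mono ih le_top

variable [M.Normal]

/-- An element of `M.relSeries j` agrees, modulo a kernel that centralizes M, with one of
γ_(j+2)(P); this gains one step over the obvious bound. -/
theorem commutator_relSeries_le (hπ : Function.Surjective π)
    (hker : ∀ k ∈ π.ker, ∀ m ∈ M, Commute k m)
    (hM : M.map π ≤ (⊤ : Subgroup G).lowerCentralSeries 1) (i j : ℕ) :
    ⁅M.relSeries i, M.relSeries j⁆ ≤ M.relSeries (i + j + 2) := by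
  rw [Subgroup.commutator_le]
  intro t ht m hm
  have h1 : π m ∈ ((⊤ : Subgroup P).lowerCentralSeries (j + 1)).map π := by
    rw [Subgroup.map_lowerCentralSeries, Subgroup.map_top_of_surjective _ hπ]
    exact map_relSeries_le M π hM j (Subgroup.mem_map_of_mem π hm)
  obtain ⟨g, hg, hgm⟩ := h1
  have h2 : g⁻¹ * m ∈ π.ker := by
    rw [MonoidHom.mem_ker, map_mul, map_inv, hgm, inv_mul_cancel]
  have h3 := hker _ h2 t (M.relSeries_antitone (Nat.zero_le i) ht)
  have h4 : ⁅t, m⁆ = ⁅t, g⁆ := by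
    rw [← mul_inv_cancel_left g m, commutatorElement_mul_right_eq_mul_conj t g (g⁻¹ * m),
      h3.symm.commutator_eq, mul_one, mul_inv_cancel_right]
  rw [h4]
  exact Subgroup.commutator_relSeries_lowerCentralSeries_le M i (j + 1)
    (Subgroup.commutator_mem_commutator ht hg)

/-- Let `π : P → G` be a surjection whose kernel centralizes the normal subgroup `M` and meets it
in the centre, where `G` has class at most five and exponent dividing `3 ^ (e + 1)`. If `M` lies
over the commutator subgroup of `G` and is generated by suitable lifts of commutators, then its
exponent divides `3 ^ (e + 1)`. -/
theorem pow_eq_one_of_central_extension {e : ℕ} (hG : ∀ g : G, g ^ 3 ^ (e + 1) = 1)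
    (h5 : (⊤ : Subgroup G).lowerCentralSeries 5 = ⊥) (hπ : Function.Surjective π)
    (hker : ∀ k ∈ π.ker, ∀ m ∈ M, Commute k m) (hcen : M ⊓ π.ker ≤ Subgroup.center P)
    (hM : M.map π ≤ (⊤ : Subgroup G).lowerCentralSeries 1) {S : Set P}
    (hS : Subgroup.closure S = M)
    (hlift : ∀ d ∈ S, ∃ (y : P) (x : G), π d = ⁅(π y)⁻¹, x⁆ ∧ y ^ 3 ^ (e + 1) = 1 ∧
      (y * d) ^ 3 ^ (e + 1) = 1) {g : P} (hg : g ∈ M) : g ^ 3 ^ (e + 1) = 1 := by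
  obtain ⟨A, hA, hApow, hA3, hAengel⟩ := exists_normal_subgroup_pow_eq_one hG h5
  have hDM : ∀ {k g}, g ∈ M.relSeries k → g ∈ M := fun {k g} h =>
    M.relSeries_antitone (Nat.zero_le k) h
  have hDπ := map_relSeries_le M π hM
  have hDD := commutator_relSeries_le M π hπ hker hM
  have hD5 : M.relSeries 5 = ⊥ := by
    refine Subgroup.commutator_top_right_eq_bot_iff_le_center.2 (le_trans ?_ hcen)
    refine le_inf (M.relSeries_antitone (Nat.zero_le 4)) ?_
    rw [← Subgroup.map_eq_bot_iff, ← le_bot_iff, ← h5]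
    exact hDπ 4
  have hDbot : ∀ {k}, 5 ≤ k → M.relSeries k = ⊥ := fun {k} hk =>
    le_bot_iff.1 ((M.relSeries_antitone hk).trans_eq hD5)
  have hDcomm : ∀ i j, 5 ≤ i + j + 2 → ∀ a ∈ M.relSeries i, ∀ b ∈ M.relSeries j,
      Commute a b := by
    intro i j hij a ha b hb
    rw [← commutatorElement_eq_one_iff_commute, ← Subgroup.mem_bot, ← hDbot hij]
    exact hDD i j (Subgroup.commutator_mem_commutator ha hb)
  have hcenA : ∀ t ∈ M, π t ∈ A → ∀ u, Commute (t ^ 3 ^ e) u := fun t ht htA u =>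
    (Subgroup.mem_center_iff.1 (hcen (Subgroup.mem_inf.2 ⟨pow_mem ht _, by
      rw [MonoidHom.mem_ker, map_pow, hApow _ htA]⟩)) u).symm
  have hcenM : ∀ t ∈ M, ∀ u, Commute (t ^ 3 ^ (e + 1)) u := fun t ht u =>
    (Subgroup.mem_center_iff.1 (hcen (Subgroup.mem_inf.2 ⟨pow_mem ht _, by
      rw [MonoidHom.mem_ker, map_pow, hG]⟩)) u).symm
  have p3 : ∀ g ∈ M.relSeries 3, g ^ 3 ^ e = 1 := fun g hg =>
    pow_eq_one_of_mem_commutator_top (B := M.relSeries 2)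
      (fun t ht u => commutator_pow_eq_one
        (hDcomm 3 2 (by norm_num) _ (M.commutator_mem_relSeries ht u) _ ht)
        (hcenA t (hDM ht) (hA3 (hDπ 2 (Subgroup.mem_map_of_mem π ht))) u))
      (fun a ha b hb => (hDcomm 3 3 (by norm_num) a ha b hb).mul_pow _) hg
  have p2 : ∀ g ∈ M.relSeries 2, g ^ 3 ^ (e + 1) = 1 := fun g hg =>
    pow_eq_one_of_mem_commutator_top (B := M.relSeries 1)
      (fun t ht u => commutator_pow_eq_one
        (hDcomm 2 1 (by norm_num) _ (M.commutator_mem_relSeries ht u) _ ht)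
        (hcenM t (hDM ht) u))
      (fun a ha b hb => (hDcomm 2 2 (by norm_num) a ha b hb).mul_pow _) hg
  have pmul : ∀ a ∈ M, ∀ b ∈ M,
      (a * b) ^ 3 ^ (e + 1) = a ^ 3 ^ (e + 1) * b ^ 3 ^ (e + 1) := by
    intro a ha b hb
    -- Within M the series may be taken two steps per weight, so weight 4 is already trivial.
    have hanti : Antitone fun i => M.relSeries (2 * (i - 1)) := fun i j hij =>
      M.relSeries_antitone (by omega)
    have hcm := commutator_le_of_series 2 hDD
    have hb6 : M.relSeries (2 * (6 - 1)) = ⊥ := hDbot (by norm_num)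
    obtain ⟨h2, h3, -⟩ := hall_petrescu hanti hcm hb6 (x := a) (y := b) ha hb
    refine mul_pow_three_pow hanti hcm hb6 ha hb (p2 _ h2)
      (p3 _ (M.relSeries_antitone (by norm_num) h3)) fun c hc => ?_
    rw [hDbot (by norm_num), Subgroup.mem_bot] at hc
    rw [hc, one_pow]
  have p1 : ∀ g ∈ M.relSeries 1, g ^ 3 ^ (e + 1) = 1 := fun g hg => by
    refine pow_eq_one_of_mem_commutator_top (B := M) (fun t ht u => ?_)
      (fun a ha b hb => pmul a (hDM (k := 1) ha) b (hDM (k := 1) hb)) hg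
    -- Here t need not commute with ⁅t, u⁆; multiplicativity of the N-th power on M replaces that.
    have h3 : u * t * u⁻¹ = ⁅t, u⁆⁻¹ * t := by
      rw [commutatorElement_def]
      group
    have h4 : (u * t * u⁻¹) ^ 3 ^ (e + 1) = t ^ 3 ^ (e + 1) := by
      rw [conj_pow, ← (hcenM t ht u).eq, mul_inv_cancel_right]
    rw [h3, pmul _ (inv_mem (hDM (k := 1) (M.commutator_mem_relSeries (n := 0) ht u))) _ ht,
      mul_eq_right, inv_pow, inv_eq_one] at h4
    exact h4
  rw [← hS] at hg
  refine pow_eq_one_of_mem_closure (fun d hd => ?_) (by rwa [hS]) hg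
  obtain ⟨y, x, hdx, hy, hyd⟩ := hlift d hd
  have hdM : d ∈ M := hS ▸ Subgroup.subset_closure hd
  -- The element y lies outside M, so ⟨y⟩M is given weight 1; it is abelian modulo ⁅M, P⁆, which
  -- gets weight 2.
  let Γ : ℕ → Subgroup P := fun i =>
    if i ≤ 1 then Subgroup.zpowers y ⊔ M else M.relSeries (i - 1)
  have hanti : Antitone Γ := by
    intro i j hij
    by_cases hi : i ≤ 1
    · by_cases hj : j ≤ 1
      · simp [Γ, hi, hj]
      · simp only [Γ, hi, hj, if_true, if_false]
        exact (M.relSeries_antitone (Nat.zero_le _)).trans le_sup_right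
    · have hj : ¬ j ≤ 1 := by omega
      simp only [Γ, hi, hj, if_false]
      exact M.relSeries_antitone (by omega)
  have hab : ⁅Subgroup.zpowers y ⊔ M, Subgroup.zpowers y ⊔ M⁆ ≤ M.relSeries 1 := by
    have hc : ∀ m ∈ M, ∀ u : P ⧸ M.relSeries 1, Commute (QuotientGroup.mk' _ m) u := by
      intro m hm u
      obtain ⟨u, rfl⟩ := QuotientGroup.mk'_surjective _ u
      rw [← commutatorElement_eq_one_iff_commute, ← map_commutatorElement]
      exact (QuotientGroup.eq_one_iff _).2 (M.commutator_mem_relSeries (n := 0) hm u)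
    rw [Subgroup.commutator_le]
    intro a ha b hb
    obtain ⟨_, ⟨i, rfl⟩, m, hm, rfl⟩ := Subgroup.mem_sup_of_normal_right.1 ha
    obtain ⟨_, ⟨j, rfl⟩, l, hl, rfl⟩ := Subgroup.mem_sup_of_normal_right.1 hb
    rw [← QuotientGroup.eq_one_iff, ← QuotientGroup.mk'_apply, map_commutatorElement,
      commutatorElement_eq_one_iff_commute]
    simp only [map_mul, map_zpow]
    exact Commute.mul_left (Commute.mul_right ((Commute.refl _).zpow_zpow i j) (hc l hl _).symm)
      (hc m hm _)
  have hcm : ∀ i j, ⁅Γ i, Γ j⁆ ≤ Γ (i + j) := by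
    intro i j
    by_cases hi : i ≤ 1 <;> by_cases hj : j ≤ 1
    · by_cases hij : i + j ≤ 1
      · simp only [Γ, hi, hj, hij, if_true]
        exact Subgroup.commutator_le_self _
      · simp only [Γ, hi, hj, hij, if_true, if_false]
        rw [show i + j - 1 = 1 by omega]
        exact hab
    · have hij : ¬ i + j ≤ 1 := by omega
      simp only [Γ, hi, hj, hij, if_true, if_false]
      rw [Subgroup.commutator_comm]
      exact (Subgroup.commutator_mono le_rfl le_top).trans (M.relSeries_antitone
        (show i + j - 1 ≤ j - 1 + 1 by omega))
    · have hij : ¬ i + j ≤ 1 := by omega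
      simp only [Γ, hi, hj, hij, if_true, if_false]
      exact (Subgroup.commutator_mono le_rfl le_top).trans (M.relSeries_antitone
        (show i + j - 1 ≤ i - 1 + 1 by omega))
    · have hij : ¬ i + j ≤ 1 := by omega
      simp only [Γ, hi, hj, hij, if_false]
      exact (hDD _ _).trans (M.relSeries_antitone (by omega))
  have hyΓ : y ∈ Γ 1 := (le_sup_left : _ ≤ Subgroup.zpowers y ⊔ M) (Subgroup.mem_zpowers y)
  have hdΓ : d ∈ Γ 1 := (le_sup_right : _ ≤ Subgroup.zpowers y ⊔ M) hdM
  obtain ⟨h2, h3, -⟩ := hall_petrescu hanti hcm hD5 hyΓ hdΓ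
  have ha1 : ⁅d⁻¹, y⁻¹⁆ ∈ M.relSeries 1 := M.commutator_mem_relSeries (n := 0) (inv_mem hdM) _
  -- The image of ⁅d⁻¹, y⁻¹⁆ in G has the form ⁅⁅x, v⁆, v⁆ with v = (π y)⁻¹, hence lies in A.
  have hay : ⁅⁅d⁻¹, y⁻¹⁆, y⁆ ^ 3 ^ e = 1 := by
    refine commutator_pow_eq_one
      (hDcomm 2 1 (by norm_num) _ (M.commutator_mem_relSeries ha1 y) _ ha1)
      (hcenA _ (hDM ha1) ?_ y)
    rw [map_commutatorElement, map_inv, map_inv, hdx, commutatorElement_inv]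
    exact hAengel x (π y)⁻¹
  have hcube : ∃ m ∈ M.relSeries 3, hallCube y d = ⁅⁅d⁻¹, y⁻¹⁆, y⁆ * m := by
    refine ⟨⁅⁅d⁻¹, y⁻¹⁆, y⁆⁻¹ * hallCube y d, ?_, by rw [mul_inv_cancel_left]⟩
    have hq := hallCube_eq_of_commutator_mem_center
      (x := (QuotientGroup.mk' (M.relSeries 3)) y) (y := QuotientGroup.mk' (M.relSeries 3) d) (by
        intro u
        rw [Subgroup.mem_center_iff]
        intro v
        obtain ⟨u, rfl⟩ := QuotientGroup.mk'_surjective _ u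
        obtain ⟨v, rfl⟩ := QuotientGroup.mk'_surjective _ v
        refine Eq.symm (commutatorElement_eq_one_iff_mul_comm.1 ?_)
        simp only [← map_inv, ← map_commutatorElement]
        exact (QuotientGroup.eq_one_iff _).2
          (M.commutator_mem_relSeries (M.commutator_mem_relSeries ha1 u) v))
    have had : QuotientGroup.mk' (M.relSeries 3) ⁅⁅d⁻¹, y⁻¹⁆, d⁆ = 1 :=
      (QuotientGroup.eq_one_iff _).2
        (hDD 1 0 (Subgroup.commutator_mem_commutator ha1 hdM))
    simp only [← map_inv, ← map_commutatorElement] at hq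
    rw [had, one_pow, mul_one, ← map_hallCube] at hq
    rw [← QuotientGroup.eq_one_iff, ← QuotientGroup.mk'_apply, map_mul, hq, ← map_mul,
      inv_mul_cancel, map_one]
  obtain ⟨m, hm, hm'⟩ := hcube
  have hcube' : hallCube y d ^ 3 ^ e = 1 := by
    rw [hm', (hDcomm 2 3 (by norm_num) _ (M.commutator_mem_relSeries ha1 y) _ hm).mul_pow, hay,
      p3 m hm, one_mul]
  have := mul_pow_three_pow hanti hcm hD5 hyΓ hdΓ (p1 _ h2) hcube' (fun c hc => by
    rw [pow_succ, pow_mul, p3 c hc, one_pow])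
  rw [hy, hyd, one_mul] at this
  exact this.symm

end CentralExtension

/-! ### The crossed module G ∧ G → G and its semidirect product. -/

namespace ExteriorSquare

variable {G : Type*} [Group G]

/-- The generator `g ∧ h`. -/
def wedge (g h : G) : ExteriorSquare G := PresentedGroup.of (g, h)

theorem closure_range_wedge :
    Subgroup.closure (Set.range fun p : G × G => wedge p.1 p.2) = ⊤ :=
  PresentedGroup.closure_range_of _

theorem wedge_self (g : G) : wedge g g = 1 :=
  PresentedGroup.one_of_mem (ExteriorSquareRel.diag g)

/-- The homomorphism out of `G ∧ G` induced by a map respecting the defining relations. -/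
def lift {H : Type*} [Group H] (f : G → G → H)
    (h1 : ∀ g g' h, f (g * g') h = f (g'⁻¹ * g * g') (g'⁻¹ * h * g') * f g' h)
    (h2 : ∀ g h h', f g (h * h') = f g h' * f (h'⁻¹ * g * h') (h'⁻¹ * h * h'))
    (h3 : ∀ g, f g g = 1) : ExteriorSquare G →* H :=
  PresentedGroup.toGroup (f := fun p : G × G => f p.1 p.2) (by
    rintro _ (⟨g, g', h⟩ | ⟨g, h, h'⟩ | g)
    · simp only [map_mul, map_inv, FreeGroup.lift_apply_of]
      rw [h1 g g' h, mul_inv_cancel]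
    · simp only [map_mul, map_inv, FreeGroup.lift_apply_of]
      rw [h2 g h h', mul_inv_cancel]
    · simp only [FreeGroup.lift_apply_of, h3])

@[simp]
theorem lift_wedge {H : Type*} [Group H] (f : G → G → H) (h1 h2 h3) (g h : G) :
    lift f h1 h2 h3 (wedge g h) = f g h :=
  PresentedGroup.toGroup.of _

@[ext]
theorem hom_ext {H : Type*} [Group H] {f f' : ExteriorSquare G →* H}
    (h : ∀ a b, f (wedge a b) = f' (wedge a b)) : f = f' :=
  PresentedGroup.ext fun p => h p.1 p.2

theorem wedge_mul_left (g g' h : G) :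
    wedge (g * g') h = wedge (g'⁻¹ * g * g') (g'⁻¹ * h * g') * wedge g' h :=
  PresentedGroup.mk_eq_mk_of_mul_inv_mem (ExteriorSquareRel.mul_left g g' h)

theorem wedge_mul_right (g h h' : G) :
    wedge g (h * h') = wedge g h' * wedge (h'⁻¹ * g * h') (h'⁻¹ * h * h') :=
  PresentedGroup.mk_eq_mk_of_mul_inv_mem (ExteriorSquareRel.mul_right g h h')

/-- Conjugation by `x⁻¹`, written as a right action on `G ∧ G`. -/
def act (x : G) : ExteriorSquare G →* ExteriorSquare G :=
  lift (fun g h => wedge (x⁻¹ * g * x) (x⁻¹ * h * x))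
    (fun g g' h => by
      rw [show x⁻¹ * (g * g') * x = (x⁻¹ * g * x) * (x⁻¹ * g' * x) by group, wedge_mul_left]
      congr 2 <;> group)
    (fun g h h' => by
      rw [show x⁻¹ * (h * h') * x = (x⁻¹ * h * x) * (x⁻¹ * h' * x) by group, wedge_mul_right]
      congr 2 <;> group)
    (fun g => wedge_self _)

theorem act_wedge (x g h : G) : act x (wedge g h) = wedge (x⁻¹ * g * x) (x⁻¹ * h * x) :=
  lift_wedge _ _ _ _ g h

theorem act_mul (x y : G) (m : ExteriorSquare G) : act (x * y) m = act y (act x m) := by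
  have h : act (x * y) = (act y).comp (act x) := by
    ext a b
    simp only [MonoidHom.comp_apply, act_wedge]
    congr 1 <;> group
  rw [h, MonoidHom.comp_apply]

theorem act_one (m : ExteriorSquare G) : act (1 : G) m = m := by
  have h : act (1 : G) = MonoidHom.id _ := by
    ext a b
    simp [act_wedge]
  rw [h, MonoidHom.id_apply]

theorem wedge_mul_left_act (g g' h : G) : wedge (g * g') h = act g' (wedge g h) * wedge g' h := by
  rw [act_wedge, wedge_mul_left]

theorem wedge_mul_right_act (g h h' : G) : wedge g (h * h') = wedge g h' * act h' (wedge g h) := by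
  rw [act_wedge, wedge_mul_right]

theorem wedge_one_left (h : G) : wedge 1 h = 1 := by
  have h1 := wedge_mul_left_act 1 1 h
  rwa [act_one, mul_one, left_eq_mul] at h1

/-- The commutator map `g ∧ h ↦ g⁻¹ h⁻¹ g h`. -/
def toCommutator : ExteriorSquare G →* G :=
  lift (fun g h => g⁻¹ * h⁻¹ * g * h) (fun g g' h => by group) (fun g h h' => by group)
    (fun g => by group)

theorem toCommutator_wedge (g h : G) : toCommutator (wedge g h) = g⁻¹ * h⁻¹ * g * h :=
  lift_wedge _ _ _ _ g h

theorem toCommutator_act (x : G) (m : ExteriorSquare G) :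
    toCommutator (act x m) = x⁻¹ * toCommutator m * x := by
  have h : toCommutator.comp (act x) = (MulAut.conj x⁻¹).toMonoidHom.comp toCommutator := by
    ext a b
    simp only [MonoidHom.comp_apply, act_wedge, toCommutator_wedge, MulEquiv.toMonoidHom_eq_coe,
      MonoidHom.coe_coe, MulAut.conj_apply]
    group
  have h' := DFunLike.congr_fun h m
  simpa using h'

theorem induction_on {C : ExteriorSquare G → Prop} (m : ExteriorSquare G)
    (hw : ∀ g h, C (wedge g h)) (h1 : C 1) (hm : ∀ a b, C a → C b → C (a * b))
    (hi : ∀ a, C a → C a⁻¹) : C m := by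
  have hmem : m ∈ Subgroup.closure (Set.range fun p : G × G => wedge p.1 p.2) := by
    rw [closure_range_wedge]
    exact Subgroup.mem_top m
  induction hmem using Subgroup.closure_induction with
  | mem x hx =>
    obtain ⟨p, rfl⟩ := hx
    exact hw p.1 p.2
  | one => exact h1
  | mul x y _ _ hx hy => exact hm x y hx hy
  | inv x _ hx => exact hi x hx

/-- Expand ag ∧ bh starting from the left factor and from the right one, then cancel. -/
theorem act_mul_wedge (g h : G) (t : ExteriorSquare G) :
    act (h * g) t * wedge g h = wedge g h * act (g * h) t := by
  have hhom : (act (h * g) : ExteriorSquare G →* _) =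
      (MulAut.conj (wedge g h)).toMonoidHom.comp (act (g * h)) := by
    ext a b
    simp only [MonoidHom.comp_apply, MulEquiv.toMonoidHom_eq_coe, MonoidHom.coe_coe,
      MulAut.conj_apply]
    rw [eq_mul_inv_iff_mul_eq]
    have e1 : wedge (a * g) (b * h) = act g (wedge a h) * act (h * g) (wedge a b) *
        (wedge g h * act h (wedge g b)) := by
      rw [wedge_mul_left_act, wedge_mul_right_act, wedge_mul_right_act, map_mul, ← act_mul]
    have e2 : wedge (a * g) (b * h) = act g (wedge a h) * wedge g h *
        (act (g * h) (wedge a b) * act h (wedge g b)) := by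
      rw [wedge_mul_right_act, wedge_mul_left_act, wedge_mul_left_act, map_mul, ← act_mul]
    rw [e1] at e2
    simp only [mul_assoc, mul_right_inj] at e2
    simpa only [← mul_assoc, mul_left_inj] using e2
  have h' := DFunLike.congr_fun hhom t
  simp only [MonoidHom.comp_apply, MulEquiv.toMonoidHom_eq_coe, MonoidHom.coe_coe,
    MulAut.conj_apply] at h'
  rw [h', inv_mul_cancel_right]

theorem act_wedge_commutator (g h : G) (s : ExteriorSquare G) :
    act (g⁻¹ * h⁻¹ * g * h) s = (wedge g h)⁻¹ * s * wedge g h := by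
  have h1 := act_mul_wedge g h (act (h * g)⁻¹ s)
  rw [← act_mul, ← act_mul, inv_mul_cancel, act_one] at h1
  rw [mul_assoc (wedge g h)⁻¹, h1, inv_mul_cancel_left]
  congr 2
  group

/-- The Peiffer identity for `G ∧ G → G`. -/
theorem act_toCommutator (m s : ExteriorSquare G) : act (toCommutator m) s = m⁻¹ * s * m := by
  induction m using induction_on generalizing s with
  | hw g h => rw [toCommutator_wedge, act_wedge_commutator]
  | h1 => simp [act_one]
  | hm a b ha hb =>
    rw [map_mul, act_mul, ha, hb]
    group
  | hi a ha =>
    have h := ha (a * s * a⁻¹)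
    rw [show a⁻¹ * (a * s * a⁻¹) * a = s by group] at h
    nth_rw 1 [← h]
    rw [← act_mul, ← map_mul, mul_inv_cancel, map_one, act_one, inv_inv]

/-- For m = g ∧ h, evaluate h⁻¹gh ∧ k twice: through h⁻¹gh = g · (g⁻¹h⁻¹gh), and by expanding g ∧ hk
= g ∧ (hkh⁻¹)h. -/
theorem wedge_toCommutator (m : ExteriorSquare G) (k : G) :
    wedge (toCommutator m) k = m⁻¹ * act k m := by
  induction m using induction_on with
  | hw g h =>
    rw [toCommutator_wedge]
    have e1 := wedge_mul_left_act g (g⁻¹ * h⁻¹ * g * h) k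
    have e2 := wedge_mul_right_act g (h * k * h⁻¹) h
    have e3 := wedge_mul_right_act g h k
    rw [inv_mul_cancel_right, e3, act_wedge h,
      show h⁻¹ * (h * k * h⁻¹) * h = k by group] at e2
    rw [act_wedge_commutator, show g * (g⁻¹ * h⁻¹ * g * h) = h⁻¹ * g * h by group,
      ← inv_mul_eq_iff_eq_mul.2 e2, ← inv_mul_eq_iff_eq_mul] at e1
    rw [← e1]
    group
  | h1 => simp [wedge_one_left]
  | hm a b ha hb =>
    rw [map_mul, wedge_mul_left_act, ha, hb, act_toCommutator, map_mul]
    group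
  | hi a ha =>
    have h := wedge_mul_left_act (toCommutator a) (toCommutator a)⁻¹ k
    rw [mul_inv_cancel, wedge_one_left, ha, ← map_inv (toCommutator (G := G)), act_toCommutator] at h
    rw [← inv_mul_eq_iff_eq_mul] at h
    rw [← h, map_inv]
    group

theorem act_eq_self_of_toCommutator_eq_one {m : ExteriorSquare G} (hm : toCommutator m = 1)
    (k : G) : act k m = m := by
  have h := wedge_toCommutator m k
  rw [hm, wedge_one_left] at h
  exact (inv_mul_eq_one.1 h.symm).symm

/-- The conjugation action of `G` on `G ∧ G`. -/
def conjAut : G →* MulAut (ExteriorSquare G) where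
  toFun g := MonoidHom.toMulEquiv (act g⁻¹) (act g)
    (by ext a b; simp [← act_mul, act_one]) (by ext a b; simp [← act_mul, act_one])
  map_one' := by
    ext m
    simp [act_one]
  map_mul' x y := by
    ext m
    simp [act_mul]

theorem conjAut_apply (g : G) (m : ExteriorSquare G) : conjAut g m = act g⁻¹ m := rfl

/-- The homomorphism `(G ∧ G) ⋊ G → G` combining the commutator map and the identity. -/
def semidirectHom : ExteriorSquare G ⋊[conjAut] G →* G :=
  SemidirectProduct.lift toCommutator (MonoidHom.id G) fun g => by
    ext a b
    simp [conjAut_apply, toCommutator_act]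

open SemidirectProduct in
theorem inr_mul_inl_pow (y x : G) (m : ℕ) :
    (inr y * inl (wedge y x) : ExteriorSquare G ⋊[conjAut] G) ^ m =
      inr (y ^ m) * inl (wedge (y ^ m) x) := by
  induction m with
  | zero => simp [wedge_one_left]
  | succ m ih =>
    rw [pow_succ, ih, pow_succ y, wedge_mul_left_act, map_mul inl, map_mul inr,
      show act y (wedge (y ^ m) x) = (conjAut y)⁻¹ (wedge (y ^ m) x) by
        rw [← map_inv, conjAut_apply, inv_inv],
      inl_aut_inv, map_inv]
    group

open SemidirectProduct in
/-- If `G` has class at most five and exponent dividing `3 ^ (e + 1)`, then the exponent of `G ∧ G`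
divides `3 ^ (e + 1)`. -/
theorem pow_eq_one {e : ℕ} (hG : ∀ g : G, g ^ 3 ^ (e + 1) = 1)
    (h5 : (⊤ : Subgroup G).lowerCentralSeries 5 = ⊥) (m : ExteriorSquare G) :
    m ^ 3 ^ (e + 1) = 1 := by
  have hnormal : (inl : ExteriorSquare G →* ExteriorSquare G ⋊[conjAut] G).range.Normal := by
    rw [range_inl_eq_ker_rightHom]
    infer_instance
  have hinl : ∀ m : ExteriorSquare G, semidirectHom (inl m) = toCommutator m := fun m =>
    lift_inl _ _ _ m
  have hinr : ∀ g : G, semidirectHom (inr g) = g := fun g => lift_inr _ _ _ g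
  refine inl_injective (φ := conjAut) ?_
  rw [map_pow, map_one]
  refine pow_eq_one_of_central_extension inl.range semidirectHom hG h5 (fun g => ⟨inr g, hinr g⟩)
    ?_ ?_ ?_ (S := Set.range fun p : G × G => inl (wedge p.1 p.2)) ?_ ?_ ⟨m, rfl⟩
  · rintro k hk _ ⟨t, rfl⟩
    obtain ⟨n, g⟩ := k
    rw [MonoidHom.mem_ker, mk_eq_inl_mul_inr, map_mul, hinl, hinr] at hk
    -- Kernel elements are n · (∂n)⁻¹ with ∂ the commutator map; by the Peiffer identity the two
    -- factors act inversely on G ∧ G.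
    obtain rfl := eq_inv_of_mul_eq_one_right hk
    have h : conjAut (toCommutator n)⁻¹ t = n⁻¹ * t * n := by
      rw [conjAut_apply, inv_inv, act_toCommutator]
    ext
    · simp only [mul_left, left_inl, right_inl, h, map_one, MulAut.one_apply]
      group
    · simp
  · rintro _ ⟨⟨n, rfl⟩, hn⟩
    have hn' : toCommutator n = 1 := (hinl n).symm.trans hn
    rw [Subgroup.mem_center_iff]
    rintro ⟨t, g⟩
    have h1 : conjAut g n = n := act_eq_self_of_toCommutator_eq_one hn' _
    have h2 : t * n = n * t := by
      have := act_toCommutator n t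
      rw [hn', act_one, mul_assoc, eq_inv_mul_iff_mul_eq] at this
      exact this.symm
    ext
    · simp [h1, h2]
    · simp
  · rintro _ ⟨_, ⟨n, rfl⟩, rfl⟩
    rw [hinl]
    induction n using induction_on with
    | hw g h =>
      rw [toCommutator_wedge]
      have := Subgroup.commutator_mem_lowerCentralSeries (n := 0) (Subgroup.mem_top g⁻¹) h⁻¹
      simpa [commutatorElement_def] using this
    | h1 => simp
    | hm a b ha hb => rw [map_mul]; exact mul_mem ha hb
    | hi a ha => rw [map_inv]; exact inv_mem ha
  · have : (Set.range fun p : G × G => (inl (wedge p.1 p.2) : ExteriorSquare G ⋊[conjAut] G)) =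
        inl '' (Set.range fun p : G × G => wedge p.1 p.2) := by
      rw [← Set.range_comp]
      rfl
    rw [this, ← MonoidHom.map_closure, closure_range_wedge, MonoidHom.range_eq_map]
  · rintro _ ⟨⟨y, x⟩, rfl⟩
    -- The inverse on x reconciles y⁻¹x⁻¹yx with the convention ⁅a, b⁆ = aba⁻¹b⁻¹.
    refine ⟨inr y, x⁻¹, ?_, ?_, ?_⟩
    · rw [hinl, hinr, toCommutator_wedge, commutatorElement_def, inv_inv, inv_inv]
    · rw [← map_pow, hG, map_one]
    · rw [inr_mul_inl_pow, hG, wedge_one_left, map_one, map_one, one_mul]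

end ExteriorSquare

theorem IsPGroup.exponent_eq_pow_of_ne_zero {G : Type*} [Group G] {p : ℕ}
    (hG : IsPGroup p G) (hp : p.Prime) (h0 : Monoid.exponent G ≠ 0) : ∃ e, Monoid.exponent G = p ^ e := by
  refine ⟨_, Nat.eq_prime_pow_of_unique_prime_dvd h0 fun {q} hq hqd => ?_⟩
  have := Fact.mk hp
  obtain ⟨g, hg⟩ := hq.exists_orderOf_eq_pow_factorization_exponent G
  obtain ⟨k, hk⟩ := IsPGroup.iff_orderOf.1 hG g
  have h1 : q ∣ p ^ k := by
    rw [← hk, hg]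
    exact dvd_pow_self q (hq.factorization_pos_of_dvd h0 hqd).ne'
  exact (Nat.prime_dvd_prime_iff_eq hq hp).1 (hq.dvd_of_dvd_pow h1)

theorem theorem2p4 {G : Type*} [Group G] [Group.IsNilpotent G] (hG : IsPGroup 3 G)
    (hc : Group.nilpotencyClass G ≤ 5) :
    Monoid.exponent (ExteriorSquare G) ∣ Monoid.exponent G := by
  by_cases h0 : Monoid.exponent G = 0
  · rw [h0]
    exact dvd_zero _
  obtain ⟨e, he⟩ := hG.exponent_eq_pow_of_ne_zero Nat.prime_three h0
  rw [Monoid.exponent_dvd_iff_forall_pow_eq_one]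
  intro m
  -- The main bound needs N/3 to be an integer, so exponent 1 is separate.
  cases e with
  | zero =>
    have hsub : Subsingleton G := Monoid.exp_eq_one_iff.1 (by simpa using he)
    rw [he, pow_zero, pow_one]
    induction m using ExteriorSquare.induction_on with
    | hw g h => rw [Subsingleton.elim g h, ExteriorSquare.wedge_self]
    | h1 => rfl
    | hm a b ha hb => rw [ha, hb, one_mul]
    | hi a ha => rw [ha, inv_one]
  | succ e =>
    rw [he]
    refine ExteriorSquare.pow_eq_one (fun g => ?_)
      (Subgroup.lowerCentralSeries_eq_bot_iff_nilpotencyClass_le.2 hc) m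
    rw [← he, Monoid.pow_exponent_eq_one]
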